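/- Let $G$ be a finite group and let $O\subset G$ be a union of conjugacy classes of $G$ which together generate $G$. Let $\widetilde G$ be the group generated by letters $y_g$, $g\in O$, subject to the relations $y_{g_1}y_{g_2}=y_{g_2}y_{g_2^{-1}g_1g_2}=y_{g_1g_2g_1^{-1}}y_{g_1}$ for all $g_1,g_2\in O$, let $\beta:\widetilde G\to G$ be the homomorphism with $\beta(y_g)=g$, and let $a_{(G,O)}$ be the order of $\ker\beta\cap[\widetilde G,\widetilde G]$. Let $$B_{(G,O)}=\ker\Bigl[H^2(G,\mathbb Q/\mathbb Z)\to\prod_{A}H^2(A,\mathbb Q/\mathbb Z)\Bigr],$$ where $\mathbb Q/\mathbb Z$ carries the trivial action, $A$ runs over all abelian subgroups of $G$ generated by two elements $g\in O$ and $h\in G$, and the maps are the restrictions; let $b_{(G,O)}$ be the order of $B_{(G,O)}$. Then $\ker\beta\cap[\widetilde G,\widetilde G]$ and $B_{(G,O)}$ are finite, and $$a_{(G,O)}=b_{(G,O)}.$$ Moreover, let $\mathbb F$ be the free group on letters $x_g$, $g\in O$, let $R$ be the kernel of the homomorphism $\mathbb F\to G$, $x_g\mapsto g$, identify $H_2(G,\mathbb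 Z)$ with $(R\cap[\mathbb F,\mathbb F])/[\mathbb F,R]$ by Hopf's formula, let $K_{(G,O)}$ be its subgroup generated by the classes of the commutators $[w,x_g]\in R$ with $w\in\mathbb F$, $g\in O$, and let $K_{(G,O)}^\perp$ be the group of all homomorphisms $H_2(G,\mathbb Z)\to\mathbb Q/\mathbb Z$ that vanish on $K_{(G,O)}$. Then $b_{(G,O)}$ is also the order of $K_{(G,O)}^\perp$. -/

import Mathlib

/-- `(G, O)` is an equipped group: `O` is a union of conjugacy classes of `G` which together
generate `G`. -/
structure IsEquipment {G : Type} [Group G] (O : Set G) : Prop where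
  conj_mem : ∀ g ∈ O, ∀ h : G, h * g * h⁻¹ ∈ O
  closure_eq_top : Subgroup.closure O = ⊤

namespace EquippedGroup

/-- The relations `y_a y_b = y_b y_{b⁻¹ab}` and `y_a y_b = y_{aba⁻¹} y_a` between the letters
`y_g`, `g ∈ O`. -/
def cRelations {G : Type} [Group G] (O : Set G) : Set (FreeGroup O) :=
  {r | ∃ a b c : O, (c : G) = (b : G)⁻¹ * a * b ∧
      r = (FreeGroup.of a * FreeGroup.of b) * (FreeGroup.of b * FreeGroup.of c)⁻¹} ∪
  {r | ∃ a b c : O, (c : G) = (a : G) * b * (a : G)⁻¹ ∧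
      r = (FreeGroup.of a * FreeGroup.of b) * (FreeGroup.of c * FreeGroup.of a)⁻¹}

/-- The `C`-group `G̃` of `(G, O)`: generated by letters `y_g`, `g ∈ O`, subject to `cRelations`. -/
abbrev CGroup {G : Type} [Group G] (O : Set G) : Type :=
  PresentedGroup (cRelations O)

theorem lift_cRelations {G : Type} [Group G] (O : Set G) :
    ∀ r ∈ cRelations O, FreeGroup.lift (fun g : O => (g : G)) r = 1 := by
  rintro r (⟨a, b, c, hc, rfl⟩ | ⟨a, b, c, hc, rfl⟩) <;> simp [hc, mul_assoc]

/-- The natural homomorphism `β : G̃ → G`, `y_g ↦ g`. -/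
def beta {G : Type} [Group G] (O : Set G) : CGroup O →* G :=
  PresentedGroup.toGroup (lift_cRelations O)

/-- The group `ker β ∩ [G̃, G̃]`. -/
def ambiguityGroup {G : Type} [Group G] (O : Set G) : Subgroup (CGroup O) :=
  (beta O).ker ⊓ commutator (CGroup O)

/-- The ambiguity index `a_{(G,O)}`. -/
noncomputable def ambiguityIndex {G : Type} [Group G] (O : Set G) : ℕ :=
  Nat.card (ambiguityGroup O)

/-- `ℚ/ℤ` with the trivial action of `G`. -/
noncomputable abbrev ratCircle (G : Type) [Group G] : Rep.{0} ℤ G :=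
  Rep.trivial ℤ G (AddCircle (1 : ℚ))

/-- The restriction `H²(G, ℚ/ℤ) → H²(A, ℚ/ℤ)` to a subgroup `A`. -/
noncomputable def restrictionH2 {G : Type} [Group G] (A : Subgroup G) :
    groupCohomology.H2 (ratCircle G) ⟶ groupCohomology.H2 (Rep.res A.subtype (ratCircle G)) :=
  groupCohomology.map A.subtype (CategoryTheory.CategoryStruct.id _) 2

/-- The group `B_{(G,O)}`: the classes in `H²(G, ℚ/ℤ)` whose restriction to every abelian subgroup
generated by an element of `O` and an element of `G` is trivial. -/
noncomputable def multiplier {G : Type} [Group G] (O : Set G) :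
    Submodule ℤ (groupCohomology.H2 (ratCircle G)) :=
  ⨅ A ∈ {A : Subgroup G | IsMulCommutative A ∧ ∃ g ∈ O, ∃ h : G, A = Subgroup.closure {g, h}},
    LinearMap.ker (restrictionH2 A).hom

/-- The order `b_{(G,O)}` of `B_{(G,O)}`. -/
noncomputable def multiplierOrder {G : Type} [Group G] (O : Set G) : ℕ :=
  Nat.card (multiplier O)

/-- The kernel `R` of the homomorphism from the free group `F` on letters `x_g`, `g ∈ O`, to `G`
with `x_g ↦ g`. -/
abbrev relationSubgroup {G : Type} [Group G] (O : Set G) : Subgroup (FreeGroup O) :=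
  (FreeGroup.lift (fun g : O => (g : G))).ker

/-- The subgroup `R ∩ [F, F]` of `F`. -/
abbrev hopfNumerator {G : Type} [Group G] (O : Set G) : Subgroup (FreeGroup O) :=
  relationSubgroup O ⊓ commutator (FreeGroup O)

/-- The subgroup `[F, R]`, as a subgroup of `R ∩ [F, F]` (in which it is contained). -/
abbrev hopfDenominator {G : Type} [Group G] (O : Set G) : Subgroup (hopfNumerator O) :=
  (⁅(⊤ : Subgroup (FreeGroup O)), relationSubgroup O⁆).subgroupOf (hopfNumerator O)

/-- `H₂(G, ℤ)` in the form `(R ∩ [F, F]) / [F, R]`. -/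
abbrev HopfH2 {G : Type} [Group G] (O : Set G) : Type :=
  hopfNumerator O ⧸ hopfDenominator O

/-- The subgroup `K_{(G,O)}` of `(R ∩ [F, F]) / [F, R]` generated by the commutators
`[w, x_g] = w x_g w⁻¹ x_g⁻¹ ∈ R` with `g ∈ O`, `w ∈ F`. -/
def commutatorPart {G : Type} [Group G] (O : Set G) : Subgroup (HopfH2 O) :=
  Subgroup.closure {q | ∃ r : hopfNumerator O,
    (∃ (w : FreeGroup O) (g : O), (r : FreeGroup O) = w * FreeGroup.of g * w⁻¹ * (FreeGroup.of g)⁻¹) ∧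
      q = QuotientGroup.mk r}

/-- The annihilator `K_{(G,O)}^⊥` of `K_{(G,O)}` in `Hom(H₂(G, ℤ), ℚ/ℤ)`. -/
def commutatorPartPerp {G : Type} [Group G] (O : Set G) :
    AddSubgroup (Additive (HopfH2 O) →+ AddCircle (1 : ℚ)) where
  carrier := {φ | ∀ k ∈ commutatorPart O, φ (Additive.ofMul k) = 0}
  zero_mem' := fun _ _ => rfl
  add_mem' := fun {φ ψ} hφ hψ k hk => by
    simp [AddMonoidHom.add_apply, hφ k hk, hψ k hk]
  neg_mem' := fun {φ} hφ k hk => by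
    simp [AddMonoidHom.neg_apply, hφ k hk]

end EquippedGroup

/-!
Let `F` be the free group on the letters `x_g`, `R` the kernel of `F → G` and `T = ℚ/ℤ`.

*The order of `K^⊥` is the ambiguity index.* In `G̃`, conjugation permutes the letters `y_g` as it
permutes `O` in `G` (`toCGroup_conj`), so `ker β` is central and every commutator `[w, x_g] ∈ R` dies
in `G̃`. Hence `F → G̃` induces a surjection from `H₂(G, ℤ) = (R ∩ [F, F]) / [F, R]` to
`ker β ∩ [G̃, G̃]` that kills `K`. Its kernel is exactly `K`
(`mem_commutatorPartLift_of_toCGroup_eq_one`): modulo the preimage of `K` in `F` a conjugate of a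
letter depends only on its image in `G`, so that after central corrections the letters satisfy the
relations of `G̃`; this gives a map back from `G̃`, and central corrections are invisible on `[F, F]`.
Therefore `K^⊥` is the group of characters of `ker β ∩ [G̃, G̃]`, which is abelian, and finite by
Schur's theorem on commutator subgroups; a finite abelian group has as many characters as elements.

*The order of `B` is that of `K^⊥`.* Consider the characters `ρ : R → T` that are invariant under
conjugation by `F`. For a section `s` of `F → G`, the function `ρ (s a * s b * (s (a * b))⁻¹)` is a
`2`-cocycle, and as `F` is free every class in `H²(G, T)` arises in this way
(`exists_invariant_of_cocycle`). The class becomes trivial on a subgroup `A` exactly if `ρ` extends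
to the preimage of `A` (`factor_coboundary_iff`), which by injectivity of `T` means that `ρ` kills
all elements of `R` in the commutator subgroup of that preimage. For `A` abelian and generated by
`g ∈ O` and `h`, it is enough that `ρ` kills `[w, x_g]` for one `w` over `h`
(`invariant_eq_one_of_commutator`). So `ρ` gives a class in `B` if and only if it kills the
commutators `[w, x_g] ∈ R`, that is, if its restriction to `R ∩ [F, F]` lies in `K^⊥`; every element
of `K^⊥` is such a restriction; and, taking `A = G`, two characters give the same class if and only
if they agree on `R ∩ [F, F]`.
-/

namespace EquippedGroup

/-! ### Characters with values in `ℚ/ℤ` -/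

section Extension

/-- Injectivity of `ℚ/ℤ` in terms of arbitrary groups: a character `ρ` of `M` extends along a
homomorphism `f : M →* E` as soon as it kills every element that `f` sends to a product of
commutators. -/
theorem exists_character_extension {M E : Type*} [Group M] [Group E] (f : M →* E)
    (ρ : M →* Multiplicative (AddCircle (1 : ℚ)))
    (h : ∀ m, f m ∈ commutator E → ρ m = 1) :
    ∃ σ : E →* Multiplicative (AddCircle (1 : ℚ)), ∀ m, σ (f m) = ρ m := by
  let p : M →* Abelianization E := Abelianization.of.comp f
  have hp : p.rangeRestrict.ker ≤ ρ.ker := by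
    intro m hm
    rw [MonoidHom.ker_rangeRestrict, MonoidHom.mem_ker] at hm
    apply h
    rw [← Abelianization.ker_of E]
    exact hm
  let ρ' := p.rangeRestrict.liftOfSurjective p.rangeRestrict_surjective ⟨ρ, hp⟩
  have hρ' : ∀ m, ρ' (p.rangeRestrict m) = ρ m := fun m =>
    p.rangeRestrict.liftOfRightInverse_comp_apply _ _ ⟨ρ, hp⟩ m
  obtain ⟨τ, hτ⟩ := (Module.Baer.of_divisible (AddCircle (1 : ℚ))).extension_property_addMonoidHom
    (MonoidHom.toAdditive p.range.subtype) (fun x y hxy => Subtype.val_injective hxy)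
    (MonoidHom.toAdditiveLeft ρ')
  refine ⟨(AddMonoidHom.toMultiplicativeRight τ).comp Abelianization.of, fun m => ?_⟩
  rw [← hρ']
  exact congrArg Multiplicative.ofAdd (DFunLike.congr_fun hτ (Additive.ofMul (p.rangeRestrict m)))

instance hasEnoughRootsOfUnity_ratCircle (n : ℕ) [NeZero n] :
    HasEnoughRootsOfUnity (Multiplicative (AddCircle (1 : ℚ))) n where
  prim := by
    refine ⟨Multiplicative.ofAdd ((1 / (n : ℚ) : ℚ) : AddCircle (1 : ℚ)), ?_⟩
    rw [IsPrimitiveRoot.iff_orderOf, orderOf_ofAdd_eq_addOrderOf]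
    have : Fact (0 < (1 : ℚ)) := ⟨one_pos⟩
    exact AddCircle.addOrderOf_period_div (NeZero.pos n)
  cyc := by
    have : Fact (0 < (1 : ℚ)) := ⟨one_pos⟩
    have hn : (n : ℚ) ≠ 0 := NeZero.ne _
    let ζ : Multiplicative (AddCircle (1 : ℚ)) :=
      Multiplicative.ofAdd ((1 / (n : ℚ) : ℚ) : AddCircle (1 : ℚ))
    have hz : ∀ m : ℕ, ζ ^ m = Multiplicative.ofAdd ((m / n * 1 : ℚ) : AddCircle (1 : ℚ)) := by
      intro m
      rw [← ofAdd_nsmul, ← AddCircle.coe_nsmul]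
      congr 2
      simp [div_eq_mul_inv]
    have hζ : ζ ^ n = 1 := by
      rw [hz, div_self hn, one_mul, AddCircle.coe_period, ofAdd_zero]
    refine ⟨rootsOfUnity.mkOfPowEq ζ hζ, fun x => ?_⟩
    have hx : n • Multiplicative.toAdd ((x : (Multiplicative (AddCircle (1 : ℚ)))ˣ) :
        Multiplicative (AddCircle (1 : ℚ))) = 0 := by
      rw [← toAdd_pow, ← Units.val_pow_eq_pow_val, (mem_rootsOfUnity n _).1 x.2]
      rfl
    obtain ⟨m, -, hm⟩ := (AddCircle.nsmul_eq_zero_iff (NeZero.pos n)).1 hx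
    refine ⟨m, ?_⟩
    apply Subtype.ext
    apply Units.ext
    have := hz m
    rw [hm] at this
    simpa using this

/-- A finite abelian group has as many `ℚ/ℤ`-valued characters as elements. -/
theorem card_characters (H : Type*) [CommGroup H] [Finite H] :
    Nat.card (H →* Multiplicative (AddCircle (1 : ℚ))) = Nat.card H := by
  have : NeZero (Monoid.exponent H) := ⟨Monoid.exponent_ne_zero_of_finite⟩
  rw [← CommGroup.card_monoidHom_of_hasEnoughRootsOfUnity H (Multiplicative (AddCircle (1 : ℚ)))]
  exact Nat.card_congr (toUnits.monoidHomCongrRightEquiv)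

end Extension

/-! ### Cocycles from invariant characters of a kernel -/

section Factor

variable {F G T : Type*} [Group F] [Group G] [CommGroup T] {π : F →* G}

/-- The element `s(a) s(b) s(ab)⁻¹` of the kernel of `π : F →* G`, for a set-theoretic section `s`
of `π`. -/
def factor {s : G → F} (hs : ∀ g, π (s g) = g) (a b : G) : π.ker :=
  ⟨s a * s b * (s (a * b))⁻¹, by simp [MonoidHom.mem_ker, hs]⟩

/-- A character of the kernel of `π : F →* G` is invariant if conjugation by elements of `F` does
not change its values. -/
def IsInvariant (ρ : π.ker →* T) : Prop :=
  ∀ (w : F) (r : π.ker), ρ (MulAut.conjNormal w r) = ρ r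

/-- An invariant character of `ker π` turns the factors of a section into a `2`-cocycle. -/
theorem factor_cocycle {s : G → F} (hs : ∀ g, π (s g) = g) {ρ : π.ker →* T}
    (hρ : IsInvariant ρ) (a b c : G) :
    ρ (factor hs (a * b) c) * ρ (factor hs a b) =
      ρ (factor hs b c) * ρ (factor hs a (b * c)) := by
  rw [← hρ (s a) (factor hs b c), mul_comm, ← map_mul, ← map_mul]
  congr 1
  apply Subtype.ext
  simp [factor, MulAut.conjNormal_apply, mul_assoc]

theorem ker_le_comap (π : F →* G) (A : Subgroup G) : π.ker ≤ A.comap π := fun r hr => by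
  rw [Subgroup.mem_comap, MonoidHom.mem_ker.1 hr]
  exact A.one_mem

/-- The `2`-cocycle of an invariant character `ρ` is a coboundary on a subgroup `A` exactly if `ρ`
extends to the preimage of `A`. -/
theorem factor_coboundary_iff {s : G → F} (hs : ∀ g, π (s g) = g) {ρ : π.ker →* T}
    (hρ : IsInvariant ρ) (A : Subgroup G) :
    (∃ c : G → T, ∀ a ∈ A, ∀ b ∈ A, c b / c (a * b) * c a = ρ (factor hs a b)) ↔
      ∃ σ : A.comap π →* T, ∀ r : π.ker, σ (Subgroup.inclusion (ker_le_comap π A) r) = ρ r := by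
  constructor
  · rintro ⟨c, hc⟩
    -- The extension is `w ↦ ρ (w * (s (π w))⁻¹) * c (π w)`.
    let d : F → π.ker := fun w => ⟨w * (s (π w))⁻¹, by simp [MonoidHom.mem_ker, hs]⟩
    have hd : ∀ w v, d (w * v) =
        d w * MulAut.conjNormal (s (π w)) (d v) * factor hs (π w) (π v) := by
      intro w v
      apply Subtype.ext
      simp [d, factor, MulAut.conjNormal_apply, mul_assoc]
    refine ⟨MonoidHom.mk' (fun w => ρ (d w) * c (π w)) fun w v => ?_, fun r => ?_⟩
    · change ρ (d (w * v)) * c (π (w * v)) = ρ (d w) * c (π w) * (ρ (d v) * c (π v))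
      rw [hd, map_mul, map_mul, hρ, ← hc _ w.2 _ v.2, map_mul, div_eq_mul_inv]
      have : ∀ x y z t u : T, x * y * (z * u⁻¹ * t) * u = x * t * (y * z) := by
        intro x y z t u
        rw [mul_right_comm z, ← mul_assoc, inv_mul_cancel_right, mul_comm z, mul_mul_mul_comm]
      exact this _ _ _ _ _
    · have h1 : ρ (factor hs 1 1) = c 1 := by
        rw [← hc 1 A.one_mem 1 A.one_mem]; simp
      change ρ (d r) * c (π r) = ρ r
      rw [MonoidHom.mem_ker.1 r.2, ← h1, ← map_mul]
      congr 1
      apply Subtype.ext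
      simp [d, factor, MonoidHom.mem_ker.1 r.2]
  · rintro ⟨σ, hσ⟩
    classical
    -- The value of the cochain outside `A` plays no role.
    refine ⟨fun a => if h : a ∈ A then σ ⟨s a, by simpa [hs] using h⟩ else 1, fun a ha b hb => ?_⟩
    dsimp only
    rw [← hσ, dif_pos ha, dif_pos hb, dif_pos (A.mul_mem ha hb), div_mul_eq_mul_div, div_eq_mul_inv,
      mul_comm (σ _), ← map_mul, ← map_inv, ← map_mul]
    rfl

/-- Let `u`, `v` lie over elements `g`, `h` that generate an abelian group `A`. Modulo the kernel of
an invariant character `ρ` the preimage of `A` is generated by `u`, `v` and the central image of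
`ker π`, so it is abelian as soon as `ρ` kills the commutator of `u` and `v`. -/
theorem invariant_eq_one_of_commutator {ρ : π.ker →* T} (hρ : IsInvariant ρ) {A : Subgroup G}
    {u v : F} (hA : A = Subgroup.closure {π u, π v})
    (huv : ∀ r : π.ker, (r : F) = u * v * u⁻¹ * v⁻¹ → ρ r = 1)
    (hcomm : π u * π v = π v * π u) (r : π.ker)
    (hr : Subgroup.inclusion (ker_le_comap π A) r ∈ commutator (A.comap π)) : ρ r = 1 := by
  -- The kernel of `ρ`, as a subgroup of `F`; it is normal because `ρ` is invariant.
  let N : Subgroup F := ρ.ker.map π.ker.subtype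
  have memN : ∀ r : π.ker, (r : F) ∈ N ↔ ρ r = 1 := by
    intro r
    constructor
    · rintro ⟨r', hr', h⟩
      rw [← Subtype.ext h]
      exact hr'
    · exact fun h => ⟨r, h, rfl⟩
  have : N.Normal := by
    refine ⟨?_⟩
    rintro _ ⟨r, hr, rfl⟩ w
    have := (memN (MulAut.conjNormal w r)).2 ((hρ w r).trans hr)
    simpa [MulAut.conjNormal_apply] using this
  let q := QuotientGroup.mk' N
  let S : Set F := {u, v} ∪ π.ker
  have hle : A.comap π ≤ Subgroup.closure S := by
    intro w hw
    have h1 : A ≤ (Subgroup.closure S).map π := by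
      rw [hA, Subgroup.closure_le]
      rintro _ (rfl | rfl)
      · exact ⟨u, Subgroup.subset_closure (by simp [S]), rfl⟩
      · exact ⟨v, Subgroup.subset_closure (by simp [S]), rfl⟩
    obtain ⟨w', hw', h2⟩ := h1 hw
    have h3 : w * w'⁻¹ ∈ Subgroup.closure S :=
      Subgroup.subset_closure (Or.inr (by simp [MonoidHom.mem_ker, h2]))
    simpa using mul_mem h3 hw'
  have hker : ∀ r ∈ π.ker, ∀ w, q r * q w = q w * q r := by
    intro r hr w
    rw [← map_mul, ← map_mul, QuotientGroup.mk'_eq_mk']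
    refine ⟨w⁻¹ * r⁻¹ * w * r, ?_, by group⟩
    have := (memN (MulAut.conjNormal w⁻¹ (⟨r, hr⟩ : π.ker)⁻¹ * ⟨r, hr⟩)).2
      (by rw [map_mul, hρ, map_inv, inv_mul_cancel])
    simpa [MulAut.conjNormal_apply, mul_assoc] using this
  have huv' : q u * q v = q v * q u := by
    have h4 : u * v * u⁻¹ * v⁻¹ ∈ π.ker := by simp [MonoidHom.mem_ker, hcomm]
    have h5 : q (u * v * u⁻¹ * v⁻¹) = 1 :=
      (QuotientGroup.eq_one_iff _).2 ((memN ⟨_, h4⟩).2 (huv _ rfl))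
    rw [map_mul, map_mul, map_mul, map_inv, map_inv, mul_inv_eq_one, mul_inv_eq_iff_eq_mul] at h5
    exact h5
  have hS : ∀ x ∈ S, ∀ y ∈ S, q x * q y = q y * q x := by
    rintro x (hx | hx) y (hy | hy)
    · rcases hx with rfl | rfl <;> rcases hy with rfl | rfl <;>
        first | rfl | exact huv' | exact huv'.symm
    · exact (hker y hy x).symm
    · exact hker x hx y
    · exact hker x hx y
  have hcl : ∀ x ∈ Subgroup.closure S, ∀ y ∈ Subgroup.closure S, q x * q y = q y * q x := by
    intro x hx y hy
    induction hx using Subgroup.closure_induction with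
    | mem x hx =>
      induction hy using Subgroup.closure_induction with
      | mem y hy => exact hS x hx y hy
      | one => simp
      | mul a b _ _ ha hb => rw [map_mul]; exact Commute.mul_right ha hb
      | inv a _ ha => rw [map_inv]; exact Commute.inv_right ha
    | one => simp
    | mul a b _ _ ha hb => rw [map_mul]; exact Commute.mul_left ha hb
    | inv a _ ha => rw [map_inv]; exact Commute.inv_left ha
  have hfin : commutator (A.comap π) ≤ N.comap (A.comap π).subtype := by
    rw [commutator_def, Subgroup.commutator_le]
    intro x _ y _
    rw [Subgroup.mem_comap, ← QuotientGroup.eq_one_iff]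
    change q ((x : F) * y * (x : F)⁻¹ * (y : F)⁻¹) = 1
    rw [map_mul, map_mul, map_mul, map_inv, map_inv, mul_inv_eq_one, mul_inv_eq_iff_eq_mul]
    exact hcl _ (hle x.2) _ (hle y.2)
  exact (memN r).1 (hfin hr)

end Factor

/-! ### The central extension `G̃` and Hopf's formula -/

section Central

theorem commutator_mul_center {H : Type*} [Group H] {c d : H} (hc : c ∈ Subgroup.center H)
    (hd : d ∈ Subgroup.center H) (x y : H) :
    (x * c) * (y * d) * (x * c)⁻¹ * (y * d)⁻¹ = x * y * x⁻¹ * y⁻¹ := by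
  rw [Subgroup.mem_center_iff] at hc hd
  calc (x * c) * (y * d) * (x * c)⁻¹ * (y * d)⁻¹
      = x * (c * y) * (d * (c⁻¹ * x⁻¹)) * d⁻¹ * y⁻¹ := by group
    _ = x * (y * c) * ((c⁻¹ * x⁻¹) * d) * d⁻¹ * y⁻¹ := by rw [hc, hd]
    _ = x * y * x⁻¹ * y⁻¹ := by group

/-- Two homomorphisms out of a free group that agree on the letters up to central factors agree on
the commutator subgroup. -/
theorem eqOn_commutator_of_central {X H : Type*} [Group H] (f g : FreeGroup X →* H)
    (h : ∀ x, (g (FreeGroup.of x))⁻¹ * f (FreeGroup.of x) ∈ Subgroup.center H) :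
    ∀ d ∈ commutator (FreeGroup X), f d = g d := by
  let q := QuotientGroup.mk' (Subgroup.center H)
  have hq : q.comp g = q.comp f := FreeGroup.ext_hom _ _ fun x => QuotientGroup.eq.2 (h x)
  have hc : ∀ w, ∃ c ∈ Subgroup.center H, f w = g w * c := fun w =>
    ⟨_, QuotientGroup.eq.1 (DFunLike.congr_fun hq w), by simp⟩
  suffices commutator (FreeGroup X) ≤ f.eqLocus g from this
  rw [commutator_def, Subgroup.commutator_le]
  intro x _ y _
  obtain ⟨c, hc1, hc2⟩ := hc x
  obtain ⟨d, hd1, hd2⟩ := hc y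
  change f (x * y * x⁻¹ * y⁻¹) = g (x * y * x⁻¹ * y⁻¹)
  simp only [map_mul, map_inv, hc2, hd2]
  exact commutator_mul_center hc1 hd1 _ _

end Central

section CGroup

variable {G : Type} [Group G] {O : Set G}

/-- The natural homomorphism from the free group on the letters `x_g` to the group `G̃`. -/
abbrev toCGroup (O : Set G) : FreeGroup O →* CGroup O := PresentedGroup.mk (cRelations O)

/-- The natural homomorphism from the free group on the letters `x_g` to the group `G`. -/
abbrev toG (O : Set G) : FreeGroup O →* G := FreeGroup.lift fun g : O => (g : G)

theorem toCGroup_surjective (O : Set G) : Function.Surjective (toCGroup O) :=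
  PresentedGroup.mk_surjective _

theorem toG_surjective (hO : IsEquipment O) : Function.Surjective (toG O) := by
  rw [← MonoidHom.range_eq_top, FreeGroup.range_lift_eq_closure, Subtype.range_coe,
    hO.closure_eq_top]

/-- In `G̃`, conjugation permutes the letters in the same way as it permutes `O` in `G`. -/
theorem toCGroup_conj (hO : IsEquipment O) (w : FreeGroup O) (a : O) :
    toCGroup O (w * FreeGroup.of a * w⁻¹) =
      toCGroup O (FreeGroup.of ⟨toG O w * a * (toG O w)⁻¹, hO.conj_mem a a.2 _⟩) := by
  induction w using FreeGroup.induction_on generalizing a with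
  | C1 => simp
  | of b =>
    have : toCGroup O _ = 1 := PresentedGroup.one_of_mem (rels := cRelations O)
      (Or.inr ⟨b, a, ⟨b * a * (b : G)⁻¹, hO.conj_mem a a.2 b⟩, rfl, rfl⟩)
    rw [map_mul, map_inv, mul_inv_eq_one, map_mul, map_mul] at this
    rw [map_mul, map_mul, map_inv, mul_inv_eq_iff_eq_mul, this]
    simp
  | inv_of b _ =>
    have hm : (b : G)⁻¹ * a * b ∈ O := by simpa using hO.conj_mem a a.2 (b : G)⁻¹
    have : toCGroup O _ = 1 := PresentedGroup.one_of_mem (rels := cRelations O)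
      (Or.inl ⟨a, b, ⟨(b : G)⁻¹ * a * b, hm⟩, rfl, rfl⟩)
    rw [map_mul, map_inv, mul_inv_eq_one, map_mul, map_mul] at this
    rw [map_mul, map_mul, inv_inv, map_inv, mul_assoc, inv_mul_eq_iff_eq_mul, this]
    simp
  | mul x y hx hy =>
    have : x * y * FreeGroup.of a * (x * y)⁻¹ = x * (y * FreeGroup.of a * y⁻¹) * x⁻¹ := by group
    rw [this, map_mul, map_mul, hy, ← map_mul, ← map_mul, hx]
    congr 3
    simp [mul_assoc]

theorem toCGroup_commutator_eq_one (hO : IsEquipment O) {w : FreeGroup O} {a : O}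
    (h : w * FreeGroup.of a * w⁻¹ * (FreeGroup.of a)⁻¹ ∈ relationSubgroup O) :
    toCGroup O (w * FreeGroup.of a * w⁻¹ * (FreeGroup.of a)⁻¹) = 1 := by
  rw [map_mul, map_inv, mul_inv_eq_one, toCGroup_conj hO]
  rw [MonoidHom.mem_ker, map_mul, map_inv, mul_inv_eq_one] at h
  congr 2
  apply Subtype.ext
  simpa using h

/-- The kernel of `β` is central: its elements fix all letters under conjugation. -/
theorem ker_beta_le_center (hO : IsEquipment O) : (beta O).ker ≤ Subgroup.center (CGroup O) := by
  intro z hz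
  obtain ⟨r, rfl⟩ := toCGroup_surjective O z
  have hr : toG O r = 1 := hz
  have key : toCGroup O = (MulAut.conj (toCGroup O r)).toMonoidHom.comp (toCGroup O) := by
    refine FreeGroup.ext_hom _ _ fun a => ?_
    have := toCGroup_conj hO r a
    simp only [map_mul, map_inv, hr] at this
    simpa using this.symm
  rw [Subgroup.mem_center_iff]
  intro y
  obtain ⟨w, rfl⟩ := toCGroup_surjective O y
  have := DFunLike.congr_fun key w
  simp only [MonoidHom.comp_apply, MulEquiv.toMonoidHom_eq_coe, MonoidHom.coe_coe,
    MulAut.conj_apply] at this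
  rw [eq_mul_inv_iff_mul_eq] at this
  exact this

theorem map_commutator_toCGroup :
    (commutator (FreeGroup O)).map (toCGroup O) = commutator (CGroup O) := by
  rw [commutator_def, Subgroup.map_commutator, ← MonoidHom.range_eq_map,
    MonoidHom.range_eq_top.2 (toCGroup_surjective O), commutator_def]

/-- The restriction of `F → G̃` to `R ∩ [F, F] → ker β ∩ [G̃, G̃]`. -/
def numeratorToAmbiguity (O : Set G) : hopfNumerator O →* ambiguityGroup O :=
  ((toCGroup O).comp (hopfNumerator O).subtype).codRestrict (ambiguityGroup O) fun d =>
    ⟨d.2.1, map_commutator_toCGroup (O := O) ▸ Subgroup.mem_map_of_mem _ d.2.2⟩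

theorem numeratorToAmbiguity_surjective (O : Set G) :
    Function.Surjective (numeratorToAmbiguity O) := by
  rintro ⟨z, hz1, hz2⟩
  rw [← map_commutator_toCGroup] at hz2
  obtain ⟨d, hd, rfl⟩ := hz2
  exact ⟨⟨d, hz1, hd⟩, rfl⟩

theorem numeratorToAmbiguity_eq_one_iff (d : hopfNumerator O) :
    numeratorToAmbiguity O d = 1 ↔ toCGroup O d = 1 :=
  Subtype.ext_iff

theorem hopfDenominator_le_ker (hO : IsEquipment O) :
    hopfDenominator O ≤ (numeratorToAmbiguity O).ker := by
  intro d hd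
  rw [MonoidHom.mem_ker, numeratorToAmbiguity_eq_one_iff]
  have : ⁅(⊤ : Subgroup (FreeGroup O)), relationSubgroup O⁆ ≤ (toCGroup O).ker := by
    rw [Subgroup.commutator_le]
    intro x _ r hr
    have := Subgroup.mem_center_iff.1 (ker_beta_le_center hO (x := toCGroup O r) hr) (toCGroup O x)
    rw [MonoidHom.mem_ker]
    change toCGroup O (x * r * x⁻¹ * r⁻¹) = 1
    rw [map_mul, map_mul, map_mul, map_inv, map_inv, mul_inv_eq_one, mul_inv_eq_iff_eq_mul, this]
  exact this hd

/-- The surjection of `H₂(G, ℤ)` onto `ker β ∩ [G̃, G̃]`. -/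
def hopfToAmbiguity (hO : IsEquipment O) : HopfH2 O →* ambiguityGroup O :=
  QuotientGroup.lift _ (numeratorToAmbiguity O) (hopfDenominator_le_ker hO)

theorem commutatorPart_le_ker (hO : IsEquipment O) :
    commutatorPart O ≤ (hopfToAmbiguity hO).ker := by
  rw [commutatorPart, Subgroup.closure_le]
  rintro _ ⟨r, ⟨w, g, hr⟩, rfl⟩
  refine (numeratorToAmbiguity_eq_one_iff r).2 ?_
  have := r.2.1
  rw [hr] at this ⊢
  exact toCGroup_commutator_eq_one hO this

theorem denominator_mk_eq_one {d : hopfNumerator O}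
    (hd : (d : FreeGroup O) ∈ ⁅(⊤ : Subgroup (FreeGroup O)), relationSubgroup O⁆) :
    (QuotientGroup.mk d : HopfH2 O) = 1 :=
  (QuotientGroup.eq_one_iff d).2 hd

/-- The preimage in `F` of `K_{(G,O)}`. -/
def commutatorPartLift (O : Set G) : Subgroup (FreeGroup O) :=
  ((commutatorPart O).comap (QuotientGroup.mk' (hopfDenominator O))).map (hopfNumerator O).subtype

theorem mem_commutatorPartLift {d : hopfNumerator O} :
    (d : FreeGroup O) ∈ commutatorPartLift O ↔
      (QuotientGroup.mk d : HopfH2 O) ∈ commutatorPart O := by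
  constructor
  · rintro ⟨e, he, h⟩
    rw [← Subtype.ext h]
    exact he
  · exact fun h => ⟨d, h, rfl⟩

theorem denominator_le_numerator (O : Set G) :
    ⁅(⊤ : Subgroup (FreeGroup O)), relationSubgroup O⁆ ≤ hopfNumerator O :=
  le_inf (Subgroup.commutator_le_right _ _)
    (commutator_def (FreeGroup O) ▸ Subgroup.commutator_mono le_rfl le_top)

theorem denominator_le_commutatorPartLift (O : Set G) :
    ⁅(⊤ : Subgroup (FreeGroup O)), relationSubgroup O⁆ ≤ commutatorPartLift O := by
  intro d hd
  have := mem_commutatorPartLift (d := ⟨d, denominator_le_numerator O hd⟩)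
  rw [denominator_mk_eq_one hd] at this
  exact this.2 (one_mem _)

theorem commutatorPartLift_le (O : Set G) : commutatorPartLift O ≤ hopfNumerator O := by
  rintro _ ⟨d, -, rfl⟩
  exact d.2

instance commutatorPartLift_normal (O : Set G) : (commutatorPartLift O).Normal := by
  refine ⟨fun d hd w => ?_⟩
  have h : w * d * w⁻¹ * d⁻¹ ∈ commutatorPartLift O :=
    denominator_le_commutatorPartLift O
      (Subgroup.commutator_mem_commutator (Subgroup.mem_top w) (commutatorPartLift_le O hd).1)
  simpa using mul_mem h hd

theorem commutator_mem_commutatorPartLift {w : FreeGroup O} {g : O}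
    (h : w * FreeGroup.of g * w⁻¹ * (FreeGroup.of g)⁻¹ ∈ relationSubgroup O) :
    w * FreeGroup.of g * w⁻¹ * (FreeGroup.of g)⁻¹ ∈ commutatorPartLift O :=
  (mem_commutatorPartLift (d := ⟨_, h,
    Subgroup.commutator_mem_commutator (Subgroup.mem_top w) (Subgroup.mem_top _)⟩)).2
    (Subgroup.subset_closure ⟨_, ⟨w, g, rfl⟩, rfl⟩)

/-- Modulo `K_{(G,O)}` the conjugate of a letter `x_g` by `w` depends only on the conjugate of `g`
by the image of `w` in `G`. -/
theorem conj_mk_eq_of_conj_eq {w v : FreeGroup O} {g : O}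
    (h : toG O w * g * (toG O w)⁻¹ = toG O v * g * (toG O v)⁻¹) :
    (QuotientGroup.mk (w * FreeGroup.of g * w⁻¹) : FreeGroup O ⧸ commutatorPartLift O) =
      QuotientGroup.mk (v * FreeGroup.of g * v⁻¹) := by
  have h1 : (w⁻¹ * v) * FreeGroup.of g * (w⁻¹ * v)⁻¹ * (FreeGroup.of g)⁻¹ ∈ relationSubgroup O := by
    rw [MonoidHom.mem_ker]
    have : ((toG O w)⁻¹ * toG O v) * g * ((toG O w)⁻¹ * toG O v)⁻¹ * (g : G)⁻¹ =
        (toG O w)⁻¹ * (toG O v * g * (toG O v)⁻¹) * toG O w * (g : G)⁻¹ := by group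
    simp only [map_mul, map_inv, FreeGroup.lift_apply_of, this]
    rw [← h]
    group
  have h2 := (commutatorPartLift_normal O).conj_mem _ (commutator_mem_commutatorPartLift h1)
    (w * (FreeGroup.of g)⁻¹)
  rw [QuotientGroup.eq]
  convert h2 using 1
  group

theorem mk_mem_center {r : FreeGroup O} (hr : r ∈ relationSubgroup O) :
    (QuotientGroup.mk r : FreeGroup O ⧸ commutatorPartLift O) ∈ Subgroup.center _ := by
  rw [Subgroup.mem_center_iff]
  intro y
  induction y using QuotientGroup.induction_on with
  | H w =>
    rw [← QuotientGroup.mk_mul, ← QuotientGroup.mk_mul]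
    refine (QuotientGroup.eq.2 ?_).symm
    have := denominator_le_commutatorPartLift O
      (Subgroup.commutator_mem_commutator (Subgroup.mem_top w⁻¹) (inv_mem hr))
    convert this using 1
    simp only [commutatorElement_def]
    group

/-- Modulo `K_{(G,O)}` the letters `x_g` can be corrected by central factors to elements `z_g` that
are permuted by conjugation as the elements of `O` are: transport one letter from each conjugacy
class. -/
theorem exists_equivariant_letters (hO : IsEquipment O) :
    ∃ z : O → FreeGroup O,
      (∀ g, toG O (z g) = g) ∧
      ∀ (w : FreeGroup O) (a b : O), (b : G) = toG O w * a * (toG O w)⁻¹ →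
        (QuotientGroup.mk (w * z a * w⁻¹) : FreeGroup O ⧸ commutatorPartLift O) =
          QuotientGroup.mk (z b) := by
  have hrep : ∀ g : O, ∃ w : FreeGroup O,
      toG O w * Quotient.out (ConjClasses.mk (g : G)) * (toG O w)⁻¹ = g := by
    intro g
    have : IsConj (Quotient.out (ConjClasses.mk (g : G))) (g : G) :=
      Quotient.exact (Quotient.out_eq (ConjClasses.mk (g : G)))
    obtain ⟨c, hc⟩ := isConj_iff.1 this
    obtain ⟨w, rfl⟩ := toG_surjective hO c
    exact ⟨w, hc⟩
  choose t ht using hrep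
  have hmem : ∀ g : O, Quotient.out (ConjClasses.mk (g : G)) ∈ O := by
    intro g
    have h := ht g
    rw [mul_inv_eq_iff_eq_mul, ← eq_inv_mul_iff_mul_eq, ← mul_assoc] at h
    rw [h]
    simpa using hO.conj_mem g g.2 (toG O (t g))⁻¹
  refine ⟨fun g => t g * FreeGroup.of ⟨_, hmem g⟩ * (t g)⁻¹, fun g => by simpa using ht g, ?_⟩
  intro w a b hb
  have hab : (⟨_, hmem b⟩ : O) = ⟨_, hmem a⟩ := by
    apply Subtype.ext
    have : ConjClasses.mk (b : G) = ConjClasses.mk (a : G) :=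
      ConjClasses.mk_eq_mk_iff_isConj.2 (isConj_iff.2 ⟨toG O w, hb.symm⟩).symm
    simp only [this]
  dsimp only
  rw [hab]
  have e : w * (t a * FreeGroup.of ⟨_, hmem a⟩ * (t a)⁻¹) * w⁻¹ =
      (w * t a) * FreeGroup.of ⟨_, hmem a⟩ * (w * t a)⁻¹ := by group
  rw [e]
  apply conj_mk_eq_of_conj_eq
  have h1 : toG O (t b) * Quotient.out (ConjClasses.mk (a : G)) * (toG O (t b))⁻¹ = b := by
    have h2 : Quotient.out (ConjClasses.mk (b : G)) = Quotient.out (ConjClasses.mk (a : G)) :=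
      congrArg Subtype.val hab
    rw [← h2]
    exact ht b
  have h3 : toG O (w * t a) * Quotient.out (ConjClasses.mk (a : G)) * (toG O (w * t a))⁻¹ = b := by
    rw [hb, map_mul]
    conv_rhs => rw [← ht a]
    group
  exact h3.trans h1.symm

/-- An element of `[F, F]` that dies in `G̃` lies over `K_{(G,O)}`: the letters `z_g` of
`exists_equivariant_letters` define a homomorphism from `G̃` to `F` modulo the preimage of
`K_{(G,O)}`, and it differs from the projection of `F` by central factors only, which commutators do
not see. -/
theorem mem_commutatorPartLift_of_toCGroup_eq_one (hO : IsEquipment O) {d : FreeGroup O}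
    (hd : d ∈ commutator (FreeGroup O)) (h : toCGroup O d = 1) : d ∈ commutatorPartLift O := by
  obtain ⟨z, hz1, hz2⟩ := exists_equivariant_letters hO
  let p := QuotientGroup.mk' (commutatorPartLift O)
  have hrel : ∀ r ∈ cRelations O, FreeGroup.lift (fun g : O => p (z g)) r = 1 := by
    rintro r (⟨a, b, c, hc, rfl⟩ | ⟨a, b, c, hc, rfl⟩)
    · have := hz2 (z b) c a (by rw [hz1, hc]; group)
      rw [map_mul, map_inv, mul_inv_eq_one]
      simp only [map_mul, FreeGroup.lift_apply_of]
      change p _ = p _ at this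
      rw [← this, map_mul, map_mul, map_inv, inv_mul_cancel_right]
    · have := hz2 (z a) b c (by rw [hz1, hc])
      rw [map_mul, map_inv, mul_inv_eq_one]
      simp only [map_mul, FreeGroup.lift_apply_of]
      change p _ = p _ at this
      rw [← this, map_mul, map_mul, map_inv, inv_mul_cancel_right]
  let θ : CGroup O →* FreeGroup O ⧸ commutatorPartLift O := PresentedGroup.toGroup hrel
  have hθ := eqOn_commutator_of_central (θ.comp (toCGroup O)) p (fun g => by
    have h1 : θ (toCGroup O (FreeGroup.of g)) = p (z g) := PresentedGroup.toGroup.of hrel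
    rw [MonoidHom.comp_apply, h1, ← map_inv, ← map_mul]
    exact mk_mem_center (by simp [MonoidHom.mem_ker, hz1])) d hd
  rw [MonoidHom.comp_apply, h, map_one] at hθ
  exact (QuotientGroup.eq_one_iff d).1 hθ.symm

theorem ker_hopfToAmbiguity (hO : IsEquipment O) : (hopfToAmbiguity hO).ker = commutatorPart O := by
  refine le_antisymm (fun x hx => ?_) (commutatorPart_le_ker hO)
  induction x using QuotientGroup.induction_on with
  | H d =>
    exact mem_commutatorPartLift.1 (mem_commutatorPartLift_of_toCGroup_eq_one hO d.2.2
      ((numeratorToAmbiguity_eq_one_iff d).1 hx))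

theorem hopfToAmbiguity_surjective (hO : IsEquipment O) :
    Function.Surjective (hopfToAmbiguity hO) := fun z => by
  obtain ⟨d, rfl⟩ := numeratorToAmbiguity_surjective O z
  exact ⟨QuotientGroup.mk d, rfl⟩

/-- By Schur's theorem: `G̃` is a central extension of the finite group `G`. -/
theorem finite_ambiguityGroup [Finite G] (hO : IsEquipment O) : Finite (ambiguityGroup O) := by
  have hfin : Finite (CGroup O ⧸ (beta O).ker) :=
    Finite.of_equiv _ (QuotientGroup.quotientKerEquivRange (beta O)).symm.toEquiv
  have : Finite (commutatorSet (CGroup O)) := by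
    -- A commutator depends only on the classes of its entries modulo the centre.
    let ψ : (CGroup O ⧸ (beta O).ker) × (CGroup O ⧸ (beta O).ker) → CGroup O :=
      fun x => x.1.out * x.2.out * x.1.out⁻¹ * x.2.out⁻¹
    refine Set.Finite.subset (Set.finite_range ψ) ?_
    rintro _ ⟨x, y, rfl⟩
    refine ⟨(QuotientGroup.mk x, QuotientGroup.mk y), ?_⟩
    obtain ⟨⟨c, hc⟩, hx⟩ := QuotientGroup.mk_out_eq_mul (beta O).ker x
    obtain ⟨⟨d, hd⟩, hy⟩ := QuotientGroup.mk_out_eq_mul (beta O).ker y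
    simp only [ψ, hx, hy]
    exact commutator_mul_center (ker_beta_le_center hO hc) (ker_beta_le_center hO hd) x y
  have : Finite (commutator (CGroup O)) := inferInstance
  exact Finite.Set.subset (commutator (CGroup O) : Set (CGroup O)) fun _ h => h.2

theorem ambiguityGroup_mul_comm (hO : IsEquipment O) (x y : ambiguityGroup O) : x * y = y * x :=
  Subtype.ext (Subgroup.mem_center_iff.1 (ker_beta_le_center hO y.2.1) x)

/-- `K_{(G,O)}^⊥` consists of the characters of `H₂(G, ℤ)` that factor through its quotient
`ker β ∩ [G̃, G̃]` by `K_{(G,O)}`. -/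
theorem card_commutatorPartPerp [Finite G] (hO : IsEquipment O) :
    Nat.card (commutatorPartPerp O) = Nat.card (ambiguityGroup O) := by
  let _ : CommGroup (ambiguityGroup O) :=
    { (inferInstance : Group (ambiguityGroup O)) with mul_comm := ambiguityGroup_mul_comm hO }
  have := finite_ambiguityGroup hO
  rw [← card_characters (ambiguityGroup O)]
  symm
  let q := hopfToAmbiguity hO
  have hq : Function.Surjective q := hopfToAmbiguity_surjective hO
  refine Nat.card_congr (Equiv.ofBijective (fun χ => ⟨MonoidHom.toAdditiveLeft (χ.comp q), ?_⟩)
    ⟨?_, ?_⟩)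
  · intro k hk
    change Multiplicative.toAdd (χ (q k)) = 0
    rw [MonoidHom.mem_ker.1 ((ker_hopfToAmbiguity hO).symm ▸ hk : k ∈ q.ker), map_one, toAdd_one]
  · intro χ χ' h
    refine MonoidHom.ext fun x => ?_
    obtain ⟨k, rfl⟩ := hq x
    exact DFunLike.congr_fun (congrArg Subtype.val h) (Additive.ofMul k)
  · rintro ⟨φ, hφ⟩
    have hle : q.ker ≤ (AddMonoidHom.toMultiplicativeRight φ).ker := by
      intro k hk
      rw [ker_hopfToAmbiguity hO] at hk
      exact congrArg Multiplicative.ofAdd (hφ k hk)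
    refine ⟨q.liftOfSurjective hq ⟨_, hle⟩, ?_⟩
    apply Subtype.ext
    refine AddMonoidHom.ext fun k => ?_
    exact congrArg Multiplicative.toAdd
      (q.liftOfRightInverse_comp_apply _ (Function.rightInverse_surjInv hq) ⟨_, hle⟩
        (Additive.toMul k))

end CGroup

/-! ### Cocycles on free groups -/

section FactorSet

/-- The extension of `G` by the trivial module `A` with `2`-cocycle `f`: pairs `(a, g)` with
`(a, g) (b, h) = (a + b + f (g, h), g h)`. -/
@[ext]
structure CocycleExtension {G A : Type*} (f : G × G → A) where
  /-- The coordinate in the module. -/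
  fst : A
  /-- The coordinate in the group. -/
  snd : G

namespace CocycleExtension

variable {G A : Type*} [Group G] [AddCommGroup A] {f : G × G → A}

/-- The group structure of the extension, for a function that satisfies the cocycle identity. -/
abbrev group (hf : ∀ g h j, f (g * h, j) + f (g, h) = f (h, j) + f (g, h * j)) :
    Group (CocycleExtension f) :=
  letI : Mul (CocycleExtension f) := ⟨fun x y => ⟨x.1 + y.1 + f (x.2, y.2), x.2 * y.2⟩⟩
  letI : One (CocycleExtension f) := ⟨⟨-f (1, 1), 1⟩⟩
  letI : Inv (CocycleExtension f) := ⟨fun x => ⟨-x.1 - f (x.2⁻¹, x.2) - f (1, 1), x.2⁻¹⟩⟩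
  Group.ofLeftAxioms
    (fun x y z => by
      refine CocycleExtension.ext ?_ (mul_assoc _ _ _)
      change x.1 + y.1 + f (x.2, y.2) + z.1 + f (x.2 * y.2, z.2) =
        x.1 + (y.1 + z.1 + f (y.2, z.2)) + f (x.2, y.2 * z.2)
      have := hf x.2 y.2 z.2
      rw [← sub_eq_zero] at this ⊢
      rw [← this]
      abel)
    (fun x => by
      refine CocycleExtension.ext ?_ (one_mul _)
      change -f (1, 1) + x.1 + f (1, x.2) = x.1
      have := hf 1 1 x.2
      simp only [mul_one, one_mul] at this
      rw [add_left_cancel_iff] at this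
      rw [this]
      abel)
    (fun x => by
      refine CocycleExtension.ext ?_ (inv_mul_cancel _)
      change -x.1 - f (x.2⁻¹, x.2) - f (1, 1) + x.1 + f (x.2⁻¹, x.2) = -f (1, 1)
      abel)

end CocycleExtension

/-- On a free group every `2`-cocycle that comes from `G` is the coboundary of a function, because
the homomorphism to `G` lifts to the extension. -/
theorem exists_cochain_of_cocycle {X G A : Type*} [Group G] [AddCommGroup A]
    (π : FreeGroup X →* G) {f : G × G → A}
    (hf : ∀ g h j, f (g * h, j) + f (g, h) = f (h, j) + f (g, h * j)) :
    ∃ c : FreeGroup X → A, ∀ w v, c (w * v) = c w + c v + f (π w, π v) := by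
  let _ := CocycleExtension.group hf
  let φ : FreeGroup X →* CocycleExtension f :=
    FreeGroup.lift fun x => ⟨0, π (FreeGroup.of x)⟩
  let p : CocycleExtension f →* G := MonoidHom.mk' CocycleExtension.snd fun _ _ => rfl
  have hp : p.comp φ = π := FreeGroup.ext_hom _ _ fun x => by
    simp [φ, p]
  refine ⟨fun w => (φ w).fst, fun w v => ?_⟩
  dsimp only
  rw [map_mul, ← hp]
  rfl

/-- Every `2`-cocycle of `G` is, up to a coboundary, the factor set of an invariant character of the
kernel of a homomorphism from a free group onto `G`. -/
theorem exists_invariant_of_cocycle {X G A : Type*} [Group G] [AddCommGroup A]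
    {π : FreeGroup X →* G} {s : G → FreeGroup X} (hs : ∀ g, π (s g) = g) {f : G × G → A}
    (hf : ∀ g h j, f (g * h, j) + f (g, h) = f (h, j) + f (g, h * j)) :
    ∃ ρ : π.ker →* Multiplicative A, IsInvariant ρ ∧ ∃ c : G → A, ∀ g h,
      c h - c (g * h) + c g = Multiplicative.toAdd (ρ (factor hs g h)) - f (g, h) := by
  obtain ⟨c, hc⟩ := exists_cochain_of_cocycle π hf
  have h1 : ∀ g, f (1, g) = f (1, 1) := fun g => by
    have := hf 1 1 g
    simp only [mul_one, one_mul] at this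
    exact (add_left_cancel this).symm
  have h2 : ∀ g, f (g, 1) = f (1, 1) := fun g => by
    have := hf g 1 1
    simp only [mul_one] at this
    exact add_left_cancel (this.trans (add_comm _ _))
  -- The kernel of the extension is embedded by `a ↦ (a - f (1, 1), 1)`.
  let ρ : π.ker →* Multiplicative A := MonoidHom.mk'
    (fun r => Multiplicative.ofAdd (c r + f (1, 1))) fun r r' => by
      rw [← ofAdd_add, Subgroup.coe_mul, hc, MonoidHom.mem_ker.1 r.2, MonoidHom.mem_ker.1 r'.2]
      congr 1
      abel
  have hρ : ∀ (r : π.ker) (w : FreeGroup X),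
      c (r * w) = Multiplicative.toAdd (ρ r) + c w := by
    intro r w
    rw [hc, MonoidHom.mem_ker.1 r.2, h1]
    change _ = c r + f (1, 1) + c w
    abel
  refine ⟨ρ, fun w r => ?_, fun g => c (s g), fun g h => ?_⟩
  · have e : ((MulAut.conjNormal w r : π.ker) : FreeGroup X) * w = w * r := by
      rw [MulAut.conjNormal_apply, inv_mul_cancel_right]
    have := hρ (MulAut.conjNormal w r) w
    rw [e, hc, MonoidHom.mem_ker.1 r.2, h2, add_assoc, add_comm (c w), add_right_cancel_iff] at this
    exact congrArg Multiplicative.ofAdd this.symm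
  · have := hρ (factor hs g h) (s (g * h))
    have e : (factor hs g h : FreeGroup X) * s (g * h) = s g * s h := inv_mul_cancel_right _ _
    rw [e, hc, hs, hs] at this
    rw [← sub_eq_zero] at this ⊢
    rw [← this]
    abel

end FactorSet

/-! ### Classes in `H²(G, ℚ/ℤ)` and their restrictions -/

section Cohomology

open groupCohomology

variable {G : Type} [Group G]

theorem H2π_restrict_eq_zero_iff (A : Subgroup G) (f : cocycles₂ (ratCircle G)) :
    (restrictionH2 A).hom ((H2π (ratCircle G)).hom f) = 0 ↔
      ∃ c : G → AddCircle (1 : ℚ), ∀ a ∈ A, ∀ b ∈ A, c b - c (a * b) + c a = f (a, b) := by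
  have h := congrArg (fun φ => φ.hom f) (H2π_comp_map A.subtype
    (CategoryTheory.CategoryStruct.id (Rep.res A.subtype (ratCircle G))))
  change (restrictionH2 A).hom ((H2π (ratCircle G)).hom f) = _ at h
  rw [h]
  refine (H2π_eq_zero_iff _).trans ?_
  constructor
  · rintro ⟨c, hc⟩
    classical
    refine ⟨fun g => if h : g ∈ A then c ⟨g, h⟩ else 0, fun a ha b hb => ?_⟩
    have := congrFun hc (⟨a, ha⟩, ⟨b, hb⟩)
    simp only [dif_pos ha, dif_pos hb, dif_pos (A.mul_mem ha hb)]
    exact this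
  · rintro ⟨c, hc⟩
    refine ⟨fun a => c a, ?_⟩
    ext ⟨a, b⟩
    exact hc a a.2 b b.2

theorem H2π_eq_zero_iff_exists (f : cocycles₂ (ratCircle G)) :
    (H2π (ratCircle G)).hom f = 0 ↔
      ∃ c : G → AddCircle (1 : ℚ), ∀ a b, c b - c (a * b) + c a = f (a, b) := by
  refine (H2π_eq_zero_iff _).trans ?_
  constructor
  · rintro ⟨c, hc⟩
    exact ⟨c, fun a b => congrFun hc (a, b)⟩
  · rintro ⟨c, hc⟩
    refine ⟨c, ?_⟩
    ext ⟨a, b⟩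
    exact hc a b

end Cohomology

/-! ### Comparison of `B` with `K^⊥` -/

open groupCohomology

variable {G : Type} [Group G] {O : Set G}

/-- A character of `ker π` extends to `π⁻¹(A)` only if it kills the commutators of `π⁻¹(A)`; as
`ℚ/ℤ` is injective, this is also sufficient. -/
theorem exists_extension_comap_iff {F G : Type*} [Group F] [Group G] {π : F →* G}
    (ρ : π.ker →* Multiplicative (AddCircle (1 : ℚ))) (A : Subgroup G) :
    (∃ σ : A.comap π →* Multiplicative (AddCircle (1 : ℚ)),
        ∀ r : π.ker, σ (Subgroup.inclusion (ker_le_comap π A) r) = ρ r) ↔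
      ∀ r : π.ker, Subgroup.inclusion (ker_le_comap π A) r ∈ commutator (A.comap π) → ρ r = 1 := by
  constructor
  · rintro ⟨σ, hσ⟩ r hr
    rw [← hσ]
    exact Abelianization.commutator_subset_ker σ hr
  · exact exists_character_extension _ _

/-- The `2`-cocycle of an invariant character of the relation subgroup. -/
noncomputable def characterCocycle {s : G → FreeGroup O} (hs : ∀ g, toG O (s g) = g)
    (ρ : relationSubgroup O →* Multiplicative (AddCircle (1 : ℚ))) (hρ : IsInvariant ρ) :
    cocycles₂ (ratCircle G) :=
  ⟨fun p => Multiplicative.toAdd (ρ (factor hs p.1 p.2)),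
    (mem_cocycles₂_iff _).2 fun a b c => factor_cocycle hs hρ a b c⟩

theorem characterCocycle_restrict_iff {s : G → FreeGroup O} (hs : ∀ g, toG O (s g) = g)
    (ρ : relationSubgroup O →* Multiplicative (AddCircle (1 : ℚ))) (hρ : IsInvariant ρ)
    (A : Subgroup G) :
    (∃ c : G → AddCircle (1 : ℚ), ∀ a ∈ A, ∀ b ∈ A,
        c b - c (a * b) + c a = characterCocycle hs ρ hρ (a, b)) ↔
      ∀ r : relationSubgroup O, Subgroup.inclusion (ker_le_comap (toG O) A) r ∈
        commutator (A.comap (toG O)) → ρ r = 1 :=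
  (factor_coboundary_iff hs hρ A).trans (exists_extension_comap_iff ρ A)

/-- A character of the relation subgroup kills the commutators `[w, x_g]` it contains. -/
def KillsLetterCommutators (ρ : relationSubgroup O →* Multiplicative (AddCircle (1 : ℚ))) : Prop :=
  ∀ (r : relationSubgroup O) (w : FreeGroup O) (g : O),
    (r : FreeGroup O) = w * FreeGroup.of g * w⁻¹ * (FreeGroup.of g)⁻¹ → ρ r = 1

theorem characterCocycle_mem_multiplier_iff {s : G → FreeGroup O} (hs : ∀ g, toG O (s g) = g)
    (ρ : relationSubgroup O →* Multiplicative (AddCircle (1 : ℚ))) (hρ : IsInvariant ρ) :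
    (H2π (ratCircle G)).hom (characterCocycle hs ρ hρ) ∈ multiplier O ↔
      KillsLetterCommutators ρ := by
  have key := fun A : Subgroup G => (H2π_restrict_eq_zero_iff A (characterCocycle hs ρ hρ)).trans
    (characterCocycle_restrict_iff hs ρ hρ A)
  simp only [multiplier, Submodule.mem_iInf, LinearMap.mem_ker, Set.mem_ofPred_eq]
  constructor
  · intro h r w g hr
    have hrk : toG O (r : FreeGroup O) = 1 := r.2
    rw [hr, map_mul, map_mul, map_mul, map_inv, map_inv, mul_inv_eq_one, mul_inv_eq_iff_eq_mul,
      FreeGroup.lift_apply_of] at hrk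
    have hcomm : IsMulCommutative (Subgroup.closure {(g : G), toG O w}) :=
      Subgroup.isMulCommutative_closure (by
        rintro x (rfl | rfl) y (rfl | rfl) <;> first | rfl | exact hrk | exact hrk.symm)
    refine (key _).1 (h _ ⟨hcomm, g, g.2, toG O w, rfl⟩) r ?_
    have hw : w ∈ (Subgroup.closure {(g : G), toG O w}).comap (toG O) :=
      Subgroup.subset_closure (by simp)
    have hg : FreeGroup.of g ∈ (Subgroup.closure {(g : G), toG O w}).comap (toG O) := by
      rw [Subgroup.mem_comap, FreeGroup.lift_apply_of]
      exact Subgroup.subset_closure (by simp)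
    have := Subgroup.commutator_mem_commutator (Subgroup.mem_top (⟨w, hw⟩ :
      (Subgroup.closure {(g : G), toG O w}).comap (toG O))) (Subgroup.mem_top ⟨_, hg⟩)
    rw [commutator_def]
    convert this using 1
    exact Subtype.ext hr
  · rintro h A ⟨hA, g, hg, x, rfl⟩
    refine (key _).2 fun r hr => ?_
    refine invariant_eq_one_of_commutator hρ (u := s x) (v := FreeGroup.of ⟨g, hg⟩) ?_
      (fun r hr => h r _ _ hr) ?_ r hr
    · rw [hs, FreeGroup.lift_apply_of, Set.pair_comm]
    · rw [hs, FreeGroup.lift_apply_of]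
      exact congrArg Subtype.val (hA.is_comm.comm (⟨x, Subgroup.subset_closure (by simp)⟩ :
        Subgroup.closure {g, x}) ⟨g, Subgroup.subset_closure (by simp)⟩)

theorem H2π_characterCocycle_eq_iff {s : G → FreeGroup O} (hs : ∀ g, toG O (s g) = g)
    {ρ ρ' : relationSubgroup O →* Multiplicative (AddCircle (1 : ℚ))}
    (hρ : IsInvariant ρ) (hρ' : IsInvariant ρ') :
    (H2π (ratCircle G)).hom (characterCocycle hs ρ hρ) =
        (H2π (ratCircle G)).hom (characterCocycle hs ρ' hρ') ↔
      ∀ r : relationSubgroup O, (r : FreeGroup O) ∈ commutator (FreeGroup O) → ρ r = ρ' r := by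
  have hdiv : IsInvariant (ρ / ρ') := fun w r => by
    rw [MonoidHom.div_apply, MonoidHom.div_apply, hρ, hρ']
  have hsub : characterCocycle hs ρ hρ - characterCocycle hs ρ' hρ' =
      characterCocycle hs (ρ / ρ') hdiv := rfl
  have hr := characterCocycle_restrict_iff hs _ hdiv ⊤
  simp only [Subgroup.mem_top, true_implies] at hr
  rw [← sub_eq_zero, ← map_sub, hsub, H2π_eq_zero_iff_exists, hr]
  refine forall_congr' fun r => ?_
  rw [MonoidHom.div_apply, div_eq_one]
  refine imp_congr_left ?_
  have hmap : (commutator ((⊤ : Subgroup G).comap (toG O))).map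
      ((⊤ : Subgroup G).comap (toG O)).subtype = commutator (FreeGroup O) := by
    rw [Subgroup.map_subtype_commutator, Subgroup.comap_top, commutator_def]
  rw [← hmap]
  constructor
  · exact fun h => ⟨_, h, rfl⟩
  · rintro ⟨x, hx, h⟩
    rwa [show Subgroup.inclusion (ker_le_comap (toG O) ⊤) r = x from Subtype.ext h.symm]

theorem exists_characterCocycle_eq {s : G → FreeGroup O} (hs : ∀ g, toG O (s g) = g)
    (x : H2 (ratCircle G)) :
    ∃ (ρ : relationSubgroup O →* Multiplicative (AddCircle (1 : ℚ))) (hρ : IsInvariant ρ),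
      (H2π (ratCircle G)).hom (characterCocycle hs ρ hρ) = x := by
  induction x using H2_induction_on with
  | h f =>
    obtain ⟨ρ, hρ, c, hc⟩ := exists_invariant_of_cocycle hs (f := f)
      ((mem_cocycles₂_iff (A := ratCircle G) f).1 f.2)
    refine ⟨ρ, hρ, ?_⟩
    rw [← sub_eq_zero]
    refine (map_sub (H2π (ratCircle G)).hom _ _).symm.trans ?_
    rw [H2π_eq_zero_iff_exists]
    exact ⟨c, hc⟩

/-- The invariant characters of the relation subgroup that kill the commutators `[w, x_g]`. -/
abbrev AdmissibleCharacter (O : Set G) : Type :=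
  {ρ : relationSubgroup O →* Multiplicative (AddCircle (1 : ℚ)) //
    IsInvariant ρ ∧ KillsLetterCommutators ρ}

theorem invariant_eq_one_of_mem_denominator
    {ρ : relationSubgroup O →* Multiplicative (AddCircle (1 : ℚ))} (hρ : IsInvariant ρ)
    {r : relationSubgroup O}
    (hr : (r : FreeGroup O) ∈ ⁅(⊤ : Subgroup (FreeGroup O)), relationSubgroup O⁆) : ρ r = 1 := by
  have : ⁅(⊤ : Subgroup (FreeGroup O)), relationSubgroup O⁆ ≤
      ρ.ker.map (relationSubgroup O).subtype := by
    rw [Subgroup.commutator_le]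
    intro w _ r hr
    refine ⟨MulAut.conjNormal w ⟨r, hr⟩ * (⟨r, hr⟩ : relationSubgroup O)⁻¹, ?_, ?_⟩
    · change ρ _ = 1
      rw [map_mul, hρ, map_inv, mul_inv_cancel]
    · simp [MulAut.conjNormal_apply, commutatorElement_def]
  obtain ⟨r', hr', h⟩ := this hr
  rw [← Subtype.ext h]
  exact hr'

/-- The character of `H₂(G, ℤ)` obtained from an admissible character by restriction to
`R ∩ [F, F]`. -/
def AdmissibleCharacter.toPerp (ρ : AdmissibleCharacter O) : commutatorPartPerp O := by
  let ψ : HopfH2 O →* Multiplicative (AddCircle (1 : ℚ)) :=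
    QuotientGroup.lift _ (ρ.1.comp (Subgroup.inclusion inf_le_left)) fun d hd =>
      invariant_eq_one_of_mem_denominator ρ.2.1 (r := Subgroup.inclusion inf_le_left d) hd
  refine ⟨MonoidHom.toAdditiveLeft ψ, fun k hk => ?_⟩
  have hle : commutatorPart O ≤ ψ.ker := by
    rw [commutatorPart, Subgroup.closure_le]
    rintro _ ⟨r, ⟨w, g, hr⟩, rfl⟩
    exact ρ.2.2 (Subgroup.inclusion inf_le_left r) w g hr
  exact congrArg Multiplicative.toAdd (MonoidHom.mem_ker.1 (hle hk))

theorem AdmissibleCharacter.toPerp_apply (ρ : AdmissibleCharacter O) (d : hopfNumerator O) :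
    ρ.toPerp.1 (Additive.ofMul (QuotientGroup.mk d)) =
      Multiplicative.toAdd (ρ.1 (Subgroup.inclusion inf_le_left d)) := rfl

theorem AdmissibleCharacter.toPerp_eq_iff (ρ ρ' : AdmissibleCharacter O) :
    ρ.toPerp = ρ'.toPerp ↔
      ∀ r : relationSubgroup O, (r : FreeGroup O) ∈ commutator (FreeGroup O) → ρ.1 r = ρ'.1 r := by
  constructor
  · intro h r hr
    have := DFunLike.congr_fun (congrArg Subtype.val h)
      (Additive.ofMul (QuotientGroup.mk (⟨r, r.2, hr⟩ : hopfNumerator O)))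
    rw [toPerp_apply, toPerp_apply] at this
    exact congrArg Multiplicative.ofAdd this
  · intro h
    apply Subtype.ext
    refine AddMonoidHom.ext fun x => ?_
    obtain ⟨d, rfl⟩ := QuotientGroup.mk_surjective (Additive.toMul x)
    exact congrArg Multiplicative.toAdd (h (Subgroup.inclusion inf_le_left d) d.2.2)

/-- A character of `H₂(G, ℤ)` extends from `R ∩ [F, F]` to `R`, and every extension is invariant
because `[F, R]` lies in `R ∩ [F, F]`. -/
theorem AdmissibleCharacter.toPerp_surjective :
    Function.Surjective (AdmissibleCharacter.toPerp (O := O)) := by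
  rintro ⟨φ, hφ⟩
  let ψ : hopfNumerator O →* Multiplicative (AddCircle (1 : ℚ)) :=
    (AddMonoidHom.toMultiplicativeRight φ).comp (QuotientGroup.mk' (hopfDenominator O))
  have hψ : ∀ d : hopfNumerator O,
      (d : FreeGroup O) ∈ ⁅(⊤ : Subgroup (FreeGroup O)), relationSubgroup O⁆ → ψ d = 1 := by
    intro d hd
    change AddMonoidHom.toMultiplicativeRight φ (QuotientGroup.mk d) = 1
    rw [denominator_mk_eq_one hd, map_one]
  obtain ⟨ρ, hρ⟩ := exists_character_extension
    (Subgroup.inclusion (inf_le_left : hopfNumerator O ≤ relationSubgroup O)) ψ fun d hd => by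
      apply hψ
      have := Subgroup.mem_map_of_mem (relationSubgroup O).subtype hd
      rw [Subgroup.map_subtype_commutator] at this
      exact Subgroup.commutator_mono le_top le_rfl this
  have hinv : IsInvariant ρ := by
    intro w r
    have hm := Subgroup.commutator_mem_commutator (Subgroup.mem_top w) r.2
    have := (hρ ⟨_, denominator_le_numerator O hm⟩).trans (hψ _ hm)
    rw [← mul_inv_eq_one, ← map_inv, ← map_mul, ← this]
    congr 1
  refine ⟨⟨ρ, hinv, fun r w g hr => ?_⟩, ?_⟩
  · have hd : (r : FreeGroup O) ∈ commutator (FreeGroup O) := by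
      rw [hr]
      exact Subgroup.commutator_mem_commutator (Subgroup.mem_top w) (Subgroup.mem_top _)
    refine (hρ ⟨r, r.2, hd⟩).trans ?_
    exact congrArg Multiplicative.ofAdd (hφ _ (Subgroup.subset_closure ⟨_, ⟨w, g, hr⟩, rfl⟩))
  · apply Subtype.ext
    refine AddMonoidHom.ext fun x => ?_
    obtain ⟨d, rfl⟩ := QuotientGroup.mk_surjective (Additive.toMul x)
    exact congrArg Multiplicative.toAdd (hρ d)

/-- `B_{(G,O)}` and `K_{(G,O)}^⊥` are quotients of the same set of characters of `R`, by the same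
equivalence relation: agreement on `R ∩ [F, F]`. -/
theorem nonempty_multiplier_equiv (hO : IsEquipment O) :
    Nonempty (multiplier O ≃ commutatorPartPerp O) := by
  have hs := Function.surjInv_eq (toG_surjective hO)
  let α : AdmissibleCharacter O → multiplier O := fun ρ =>
    ⟨(H2π (ratCircle G)).hom (characterCocycle hs ρ.1 ρ.2.1),
      (characterCocycle_mem_multiplier_iff hs ρ.1 ρ.2.1).2 ρ.2.2⟩
  have hα : Function.Surjective α := by
    rintro ⟨x, hx⟩
    obtain ⟨ρ, hρ, rfl⟩ := exists_characterCocycle_eq hs x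
    exact ⟨⟨ρ, hρ, (characterCocycle_mem_multiplier_iff hs ρ hρ).1 hx⟩, rfl⟩
  have hker : Setoid.ker α = Setoid.ker AdmissibleCharacter.toPerp := Setoid.ext fun ρ ρ' => by
    rw [Setoid.ker_def, Setoid.ker_def, AdmissibleCharacter.toPerp_eq_iff, Subtype.ext_iff]
    exact H2π_characterCocycle_eq_iff hs ρ.2.1 ρ'.2.1
  exact ⟨(Setoid.quotientKerEquivOfSurjective _ hα).symm.trans ((Quotient.congrRight fun ρ ρ' => by
    rw [hker]).trans
      (Setoid.quotientKerEquivOfSurjective _ AdmissibleCharacter.toPerp_surjective))⟩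

end EquippedGroup

theorem theorem5 {G : Type} [Group G] [Finite G] (O : Set G) (hO : IsEquipment O) :
    Finite (EquippedGroup.ambiguityGroup O) ∧
      Finite (EquippedGroup.multiplier O) ∧
      EquippedGroup.ambiguityIndex O = EquippedGroup.multiplierOrder O ∧
      EquippedGroup.multiplierOrder O = Nat.card (EquippedGroup.commutatorPartPerp O) := by
  have hfin := EquippedGroup.finite_ambiguityGroup hO
  have hK := EquippedGroup.card_commutatorPartPerp hO
  obtain ⟨e⟩ := EquippedGroup.nonempty_multiplier_equiv hO
  have hB : EquippedGroup.multiplierOrder O = Nat.card (EquippedGroup.commutatorPartPerp O) :=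
    Nat.card_congr e
  refine ⟨hfin, ?_, (hB.trans hK).symm, hB⟩
  -- `Nat.card` is positive here, which rules out its junk value on infinite types.
  exact Nat.finite_of_card_ne_zero ((hB.trans hK).trans_ne Nat.card_pos.ne')
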